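/- Corollary 2.2. Let $G=\sum_{n=0}^{\infty}\frac{(-1)^n}{(2n+1)^2}$ be Catalan's constant, and for real sequences $(a_n)_{n\ge 0}$ and $(b_n)_{n\ge 1}$ write $$\mathrm{CF}[a_n,b_n]=a_0+\cfrac{b_1}{a_1+\cfrac{b_2}{a_2+\ddots}}$$ for the limit of the convergents $a_0+\cfrac{b_1}{a_1+\ddots+\cfrac{b_n}{a_n}}$ as $n\to\infty$. Then the continued fraction $\mathrm{CF}\left[3n^2+3n+1,\,-2n^3(n+1)\right]$ converges, and $$\frac{2}{2G-1}=\mathrm{CF}\left[3n^2+3n+1,\,-2n^3(n+1)\right].$$ -/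

import Mathlib

/-- Catalan's constant `G = ∑_{n ≥ 0} (-1)^n / (2 n + 1)^2` (an absolutely convergent series). -/
noncomputable def catalanConstant : ℝ :=
  ∑' n : ℕ, (-1 : ℝ) ^ n / (2 * (n : ℝ) + 1) ^ 2

/-- The formal continued fraction `CF[a_n, b_n] = a_0 + b_1 / (a_1 + b_2 / (a_2 + ⋯))`.
In Mathlib's `GenContFract`, the `n`-th entry of the sequence is the pair of the
partial numerator `b_{n+1}` and the partial denominator `a_{n+1}`. -/
def contFrac (a b : ℕ → ℝ) : GenContFract ℝ where
  h := a 0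
  s := Stream'.Seq.ofStream fun n => { a := b (n + 1), b := a (n + 1) }

/-- `CF[a_n, b_n] = v`: from some index on the convergents `A_n / B_n` have a nonzero
denominator, and they tend to the real number `v`. -/
def ContFracHasValue (a b : ℕ → ℝ) (v : ℝ) : Prop :=
  (∀ᶠ n in Filter.atTop, (contFrac a b).dens n ≠ 0) ∧
    Filter.Tendsto (fun n => (contFrac a b).nums n / (contFrac a b).dens n)
      Filter.atTop (nhds v)

/-! Write G for Catalan's constant and β_k = binom(2k, k)/4^k. Divided by (n+1)!², the continuants
become solutions u (numerators) and v (denominators) of m² x_m = (3m² − 3m + 1) x_{m−1} − 2m(m−1)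
x_{m−2}, with characteristic roots 1 and 2. The combination v − (G − 1/2) u is `minimalSolution`, at
most linear by `abs_minimalSolution_le`, while |u| grows geometrically by `dominant_growth`. Hence
v/u → G − 1/2, and inverting gives the value.

The minimal solution comes from `betaMoment`: creative telescoping (`betaMoment_recurrence`) gives
it the same recurrence with right side 2, the sequence m gives right side 1, so m − `betaMoment m`/2
is homogeneous. Its initial values rest on ∑ β_k²/(2k+1) = 4G/π (`hasSum_centralRatio_sq_div_odd`):
integrate the arcsine series for x/sin x termwise and compare with ∫ x/sin x = 2G over [0, π/2]
(`integral_inv_sinc`). -/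

/-! ### Central binomial ratios and two telescoping sums -/

/-- The normalised central binomial coefficient `binom(2k, k) / 4 ^ k`. -/
noncomputable def centralRatio (k : ℕ) : ℝ :=
  ∏ i ∈ Finset.range k, (2 * (i : ℝ) + 1) / (2 * i + 2)

lemma centralRatio_zero : centralRatio 0 = 1 := by simp [centralRatio]

lemma centralRatio_succ (k : ℕ) :
    centralRatio (k + 1) = centralRatio k * ((2 * (k : ℝ) + 1) / (2 * k + 2)) :=
  Finset.prod_range_succ _ _

lemma centralRatio_pos (k : ℕ) : 0 < centralRatio k :=
  Finset.prod_pos fun _ _ => by positivity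

lemma centralRatio_le_one (k : ℕ) : centralRatio k ≤ 1 :=
  Finset.prod_le_one (fun _ _ => by positivity) fun i _ => by
    rw [div_le_one (by positivity)]; linarith

lemma wallis_mul_centralRatio_sq (k : ℕ) :
    Real.Wallis.W k * (2 * (k : ℝ) + 1) * centralRatio k ^ 2 = 1 := by
  induction k with
  | zero => simp [centralRatio, Real.Wallis.W]
  | succ k ih =>
    rw [Real.Wallis.W_succ, centralRatio_succ]
    push_cast
    field_simp
    linear_combination (2 * (k : ℝ) + 3) * ih

lemma tendsto_mul_centralRatio_sq :
    Filter.Tendsto (fun k : ℕ => (k : ℝ) * centralRatio k ^ 2) Filter.atTop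
      (nhds (1 / Real.pi)) := by
  have h1 : Filter.Tendsto (fun k : ℕ => (k : ℝ) / (2 * k + 1)) Filter.atTop (nhds (1 / 2)) := by
    have h := tendsto_natCast_div_add_atTop (1 / 2 : ℝ)
    have := h.mul_const (1 / 2 : ℝ)
    rw [one_mul] at this
    refine this.congr fun k => ?_
    field_simp
  have h2 := h1.div Real.Wallis.tendsto_W_nhds_pi_div_two (by positivity)
  have e : (1 / 2 : ℝ) / (Real.pi / 2) = 1 / Real.pi := by field_simp
  rw [e] at h2
  refine h2.congr fun k => ?_
  have h := wallis_mul_centralRatio_sq k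
  have hW := (Real.Wallis.W_pos k).ne'
  simp only [Pi.div_apply]
  field_simp
  linear_combination (-(k : ℝ)) * h

lemma tendsto_centralRatio_sq :
    Filter.Tendsto (fun k : ℕ => centralRatio k ^ 2) Filter.atTop (nhds 0) := by
  have h := tendsto_mul_centralRatio_sq.mul (tendsto_inv_atTop_nhds_zero_nat (𝕜 := ℝ))
  rw [mul_zero] at h
  refine h.congr' ?_
  filter_upwards [Filter.eventually_gt_atTop 0] with k hk
  have : (k : ℝ) ≠ 0 := by positivity
  field_simp

lemma hasSum_congr_fun {f g : ℕ → ℝ} {a : ℝ} (h : ∀ k, f k = g k) (hg : HasSum g a) :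
    HasSum f a :=
  funext h ▸ hg

/-- A series of nonnegative terms that telescopes sums to the limit difference. -/
lemma hasSum_of_telescoping {f T : ℕ → ℝ} {l : ℝ} (hf : ∀ k, 0 ≤ f k)
    (h : ∀ k, f k = T (k + 1) - T k) (hT : Filter.Tendsto T Filter.atTop (nhds l)) :
    HasSum f (l - T 0) := by
  rw [hasSum_iff_tendsto_nat_of_nonneg hf]
  have e : (fun n => ∑ i ∈ Finset.range n, f i) = fun n => T n - T 0 := by
    funext n
    rw [← Finset.sum_range_sub]
    exact Finset.sum_congr rfl fun k _ => h k
  rw [e]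
  exact hT.sub_const _

lemma hasSum_centralRatio_sq_div_succ :
    HasSum (fun k : ℕ => centralRatio k ^ 2 / ((k : ℝ) + 1)) (4 / Real.pi) := by
  have h := hasSum_of_telescoping (f := fun k : ℕ => centralRatio k ^ 2 / ((k : ℝ) + 1))
    -- Antidifference: 4(k+1)β_{k+1}² = β_k²(2k+1)²/(k+1), and (2k+1)² = 4k(k+1) + 1.
    (T := fun k : ℕ => 4 * ((k : ℝ) * centralRatio k ^ 2)) (fun k => by positivity)
    (fun k => by
      simp only [centralRatio_succ]
      push_cast
      field_simp
      ring) (tendsto_mul_centralRatio_sq.const_mul 4)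
  convert h using 1
  simp
  ring

lemma hasSum_centralRatio_sq_div_succ_sq :
    HasSum (fun k : ℕ => centralRatio k ^ 2 / ((k : ℝ) + 1) ^ 2) (16 / Real.pi - 4) := by
  have hT := (tendsto_mul_centralRatio_sq.const_mul 16).add (tendsto_centralRatio_sq.const_mul 4)
  have h := hasSum_of_telescoping (f := fun k : ℕ => centralRatio k ^ 2 / ((k : ℝ) + 1) ^ 2)
    (T := fun k : ℕ => 16 * ((k : ℝ) * centralRatio k ^ 2) + 4 * centralRatio k ^ 2)
    (fun k => by positivity)
    (fun k => by
      simp only [centralRatio_succ]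
      push_cast
      field_simp
      ring) hT
  convert h using 1
  simp [centralRatio_zero]
  ring

/-! ### Beta moments and their recurrence -/

/-- The beta integral `∫₀¹ t ^ (2k) (1 - t) ^ m dt`. -/
noncomputable def evenBeta (k m : ℕ) : ℝ :=
  ((2 * k).factorial : ℝ) * m.factorial / ((2 * k + m + 1).factorial : ℝ)

lemma evenBeta_nonneg (k m : ℕ) : 0 ≤ evenBeta k m := by unfold evenBeta; positivity

lemma evenBeta_zero_right (k : ℕ) : evenBeta k 0 = 1 / (2 * (k : ℝ) + 1) := by
  simp only [evenBeta, add_zero, Nat.factorial_succ, Nat.factorial_zero]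
  push_cast
  have := (2 * k).factorial_ne_zero
  field_simp

lemma evenBeta_succ_right (k m : ℕ) :
    evenBeta k (m + 1) = evenBeta k m * (((m : ℝ) + 1) / (2 * k + m + 2)) := by
  have e : 2 * k + (m + 1) + 1 = (2 * k + m + 1) + 1 := by ring
  simp only [evenBeta, e, Nat.factorial_succ (2 * k + m + 1), Nat.factorial_succ m]
  push_cast
  have := (2 * k + m + 1).factorial_ne_zero
  field_simp
  ring

lemma evenBeta_succ_left (k m : ℕ) :
    evenBeta (k + 1) m = evenBeta k m *
      ((2 * (k : ℝ) + 1) * (2 * k + 2) / ((2 * k + m + 2) * (2 * k + m + 3))) := by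
  have e : 2 * (k + 1) + m + 1 = (2 * k + m + 1) + 1 + 1 := by ring
  have e' : 2 * (k + 1) = 2 * k + 1 + 1 := by ring
  simp only [evenBeta, e, Nat.factorial_succ (2 * k + m + 1), Nat.factorial_succ (2 * k + m + 1 + 1)]
  simp only [e', Nat.factorial_succ (2 * k), Nat.factorial_succ (2 * k + 1)]
  push_cast
  have := (2 * k + m + 1).factorial_ne_zero
  field_simp
  ring

lemma evenBeta_le_one (k m : ℕ) : evenBeta k m ≤ 1 := by
  induction m with
  | zero => rw [evenBeta_zero_right, div_le_one (by positivity)]; linarith [(k.cast_nonneg : (0:ℝ) ≤ k)]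
  | succ m ih =>
    rw [evenBeta_succ_right]
    refine mul_le_one₀ ih (by positivity) ?_
    rw [div_le_one (by positivity)]
    linarith [(k.cast_nonneg : (0:ℝ) ≤ k)]

/-- The moments `∑ₖ βₖ² / (k + 1) · ∫₀¹ t ^ (2k) (1 - t) ^ m dt`. -/
noncomputable def betaMoment (m : ℕ) : ℝ :=
  ∑' k : ℕ, centralRatio k ^ 2 / ((k : ℝ) + 1) * evenBeta k m

lemma summable_betaMoment (m : ℕ) :
    Summable fun k : ℕ => centralRatio k ^ 2 / ((k : ℝ) + 1) * evenBeta k m :=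
  hasSum_centralRatio_sq_div_succ.summable.of_nonneg_of_le
    (fun k => mul_nonneg (by positivity) (evenBeta_nonneg k m))
    (fun k => mul_le_of_le_one_right (by positivity) (evenBeta_le_one k m))

lemma betaMoment_nonneg (m : ℕ) : 0 ≤ betaMoment m :=
  tsum_nonneg fun k => mul_nonneg (by positivity) (evenBeta_nonneg k m)

lemma betaMoment_le (m : ℕ) : betaMoment m ≤ 4 / Real.pi := by
  rw [← hasSum_centralRatio_sq_div_succ.tsum_eq]
  exact (summable_betaMoment m).tsum_le_tsum
    (fun k => mul_le_of_le_one_right (by positivity) (evenBeta_le_one k m))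
    hasSum_centralRatio_sq_div_succ.summable

/-- Creative telescoping in k: the combined summand is the difference of −2(p+1) β_k² `evenBeta k
p`, which is −2 at k = 0 and tends to 0. -/
lemma betaMoment_recurrence (p : ℕ) :
    ((p : ℝ) + 2) ^ 2 * betaMoment (p + 2)
      - (3 * ((p : ℝ) + 2) ^ 2 - 3 * ((p : ℝ) + 2) + 1) * betaMoment (p + 1)
      + 2 * ((p : ℝ) + 2) * ((p : ℝ) + 1) * betaMoment p = 2 := by
  have hs := (((summable_betaMoment (p + 2)).hasSum.mul_left (((p : ℝ) + 2) ^ 2)).sub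
    ((summable_betaMoment (p + 1)).hasSum.mul_left
      (3 * ((p : ℝ) + 2) ^ 2 - 3 * ((p : ℝ) + 2) + 1))).add
    ((summable_betaMoment p).hasSum.mul_left (2 * ((p : ℝ) + 2) * ((p : ℝ) + 1)))
  have hT : Filter.Tendsto (fun k : ℕ => -(2 * ((p : ℝ) + 1) * (centralRatio k ^ 2 * evenBeta k p)))
      Filter.atTop (nhds (-(2 * ((p : ℝ) + 1) * 0))) := by
    refine ((squeeze_zero (fun k => mul_nonneg (by positivity) (evenBeta_nonneg k p))
      (fun k => mul_le_of_le_one_right (by positivity) (evenBeta_le_one k p))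
      tendsto_centralRatio_sq).const_mul _).neg
  refine tendsto_nhds_unique hs.tendsto_sum_nat ?_
  have e : ∀ n : ℕ, ∑ k ∈ Finset.range n,
      (((p : ℝ) + 2) ^ 2 * (centralRatio k ^ 2 / ((k : ℝ) + 1) * evenBeta k (p + 2))
        - (3 * ((p : ℝ) + 2) ^ 2 - 3 * ((p : ℝ) + 2) + 1)
          * (centralRatio k ^ 2 / ((k : ℝ) + 1) * evenBeta k (p + 1))
        + 2 * ((p : ℝ) + 2) * ((p : ℝ) + 1)
          * (centralRatio k ^ 2 / ((k : ℝ) + 1) * evenBeta k p))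
      = -(2 * ((p : ℝ) + 1) * (centralRatio n ^ 2 * evenBeta n p)) + 2 := by
    intro n
    induction n with
    | zero =>
      simp only [Finset.range_zero, Finset.sum_empty, centralRatio_zero, evenBeta, mul_zero,
        zero_add, Nat.factorial_zero, Nat.factorial_succ p]
      push_cast
      have := p.factorial_ne_zero
      field_simp
      ring
    | succ n ih =>
      rw [Finset.sum_range_succ, ih, centralRatio_succ, evenBeta_succ_left,
        show p + 2 = (p + 1) + 1 from rfl, evenBeta_succ_right n (p + 1), evenBeta_succ_right n p]
      push_cast
      field_simp
      ring
  rw [funext e]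
  simpa using hT.add_const 2

/-- Termwise, ∫ t^(2k) (1 − (1 − t)) dt = 1/(2k+2), which leaves half of the sum over (k+1)². -/
lemma betaMoment_zero_sub_one : betaMoment 0 - betaMoment 1 = 8 / Real.pi - 2 := by
  have h := (summable_betaMoment 0).hasSum.sub (summable_betaMoment 1).hasSum
  have h' := hasSum_centralRatio_sq_div_succ_sq.mul_left (1 / 2)
  have e : (1 / 2 : ℝ) * (16 / Real.pi - 4) = 8 / Real.pi - 2 := by ring
  rw [e] at h'
  refine h.unique (hasSum_congr_fun (fun k => ?_) h')
  rw [evenBeta_succ_right, evenBeta_zero_right]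
  push_cast
  field_simp
  ring

lemma betaMoment_zero {s : ℝ}
    (h : HasSum (fun k : ℕ => centralRatio k ^ 2 / (2 * (k : ℝ) + 1)) s) :
    betaMoment 0 = 2 * s - 4 / Real.pi := by
  refine HasSum.tsum_eq (hasSum_congr_fun (fun k => ?_)
    ((h.mul_left 2).sub hasSum_centralRatio_sq_div_succ))
  rw [evenBeta_zero_right]
  field_simp
  ring

/-! ### The integral of x/sin x -/

lemma sinc_pos_of_mem {x : ℝ} (hx : x ∈ Set.Icc 0 (Real.pi / 2)) : 0 < Real.sinc x := by
  rcases hx.1.eq_or_lt with h | h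
  · simp [← h]
  · rw [Real.sinc_of_ne_zero h.ne']
    exact div_pos (Real.sin_pos_of_pos_of_lt_pi h (by linarith [hx.2, Real.pi_pos])) h

lemma continuousOn_inv_sinc :
    ContinuousOn (fun x => (Real.sinc x)⁻¹) (Set.uIcc 0 (Real.pi / 2)) := by
  rw [Set.uIcc_of_le (by positivity)]
  exact Real.continuous_sinc.continuousOn.inv₀ fun x hx => (sinc_pos_of_mem hx).ne'

lemma sinc_mul_self (x : ℝ) : Real.sinc x * x = Real.sin x := by
  by_cases h : x = 0
  · simp [h]
  · rw [Real.sinc_of_ne_zero h, div_mul_cancel₀ _ h]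

lemma hasSum_catalanConstant :
    HasSum (fun n : ℕ => (-1 : ℝ) ^ n / (2 * (n : ℝ) + 1) ^ 2) catalanConstant := by
  refine Summable.hasSum (Summable.of_norm_bounded
    (g := fun n : ℕ => 1 / ((n : ℝ) + 1) ^ 2) ?_ fun n => ?_)
  · have h := (summable_nat_add_iff (f := fun n : ℕ => 1 / (n : ℝ) ^ 2) 1).mpr
      (Real.summable_one_div_nat_pow.mpr one_lt_two)
    simpa using h
  · rw [norm_div, norm_pow, norm_neg, norm_one, one_pow, Real.norm_of_nonneg (by positivity)]
    gcongr
    linarith [(n.cast_nonneg : (0 : ℝ) ≤ n)]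

lemma sin_odd_mul_pi_div_two (n : ℕ) : Real.sin ((2 * (n : ℝ) + 1) * (Real.pi / 2)) = (-1) ^ n := by
  have e : (2 * (n : ℝ) + 1) * (Real.pi / 2) = Real.pi / 2 + n * Real.pi := by ring
  rw [e, Real.sin_add_nat_mul_pi, Real.sin_pi_div_two, mul_one]

lemma cos_odd_mul_pi_div_two (n : ℕ) : Real.cos ((2 * (n : ℝ) + 1) * (Real.pi / 2)) = 0 := by
  have e : (2 * (n : ℝ) + 1) * (Real.pi / 2) = Real.pi / 2 + n * Real.pi := by ring
  rw [e, Real.cos_add_nat_mul_pi, Real.cos_pi_div_two, mul_zero]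

lemma integral_mul_sin_odd (n : ℕ) :
    ∫ x in (0 : ℝ)..(Real.pi / 2), x * Real.sin ((2 * (n : ℝ) + 1) * x)
      = (-1) ^ n / (2 * (n : ℝ) + 1) ^ 2 := by
  set a : ℝ := 2 * (n : ℝ) + 1 with ha
  have ha0 : a ≠ 0 := by positivity
  have hd : ∀ x ∈ Set.uIcc (0 : ℝ) (Real.pi / 2),
      HasDerivAt (fun x => Real.sin (a * x) / a ^ 2 - x * Real.cos (a * x) / a)
        (x * Real.sin (a * x)) x := fun x _ => by
    have hl : HasDerivAt (fun x : ℝ => a * x) a x := by simpa using (hasDerivAt_id x).const_mul a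
    refine (((hl.sin).div_const (a ^ 2)).sub
      (((hasDerivAt_id x).mul hl.cos).div_const a)).congr_deriv ?_
    simp only [id]
    field_simp
    ring
  rw [intervalIntegral.integral_eq_sub_of_hasDerivAt hd
    (Continuous.intervalIntegrable (by fun_prop) _ _), ha, sin_odd_mul_pi_div_two,
    cos_odd_mul_pi_div_two]
  simp

lemma two_mul_sin_mul_sum_sin_odd (N : ℕ) (x : ℝ) :
    2 * Real.sin x * ∑ n ∈ Finset.range N, Real.sin ((2 * (n : ℝ) + 1) * x)
      = 1 - Real.cos (2 * (N : ℝ) * x) := by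
  induction N with
  | zero => simp
  | succ N ih =>
    rw [Finset.sum_range_succ, mul_add, ih]
    have e1 : 2 * (N : ℝ) * x = (2 * (N : ℝ) + 1) * x - x := by ring
    have e2 : 2 * ((N + 1 : ℕ) : ℝ) * x = (2 * (N : ℝ) + 1) * x + x := by push_cast; ring
    rw [e1, e2, Real.cos_sub, Real.cos_add]
    ring

lemma tendsto_integral_cos_mul {f : ℝ → ℝ} {a b : ℝ} (hab : a ≤ b)
    (hf : ContinuousOn f (Set.uIcc a b)) :
    Filter.Tendsto (fun N : ℕ => ∫ x in a..b, Real.cos (2 * (N : ℝ) * x) * f x)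
      Filter.atTop (nhds 0) := by
  -- The Fourier character is exp(−2πivw), so w = N/π produces cos(2Nx).
  have hw : Filter.Tendsto (fun N : ℕ => (N : ℝ) / Real.pi) Filter.atTop
      (Filter.cocompact ℝ) :=
    (Filter.Tendsto.atTop_div_const Real.pi_pos tendsto_natCast_atTop_atTop).mono_right
      atTop_le_cocompact
  have h := (Real.tendsto_integral_exp_smul_cocompact
    (Set.indicator (Set.Ioc a b) fun x => (f x : ℂ))).comp hw
  have h' := (Complex.continuous_re.tendsto 0).comp h
  rw [Complex.zero_re] at h'
  refine h'.congr fun N => ?_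
  have e : ∀ v : ℝ, Real.fourierChar (-(v * ((N : ℝ) / Real.pi)))
      • Set.indicator (Set.Ioc a b) (fun x => (f x : ℂ)) v
      = Set.indicator (Set.Ioc a b)
        (fun x => Complex.exp (((-(2 * (N : ℝ) * x) : ℝ) : ℂ) * Complex.I) * (f x : ℂ)) v := by
    intro v
    by_cases hv : v ∈ Set.Ioc a b
    · rw [Set.indicator_of_mem hv, Set.indicator_of_mem hv, Circle.smul_def,
        Real.fourierChar_apply, smul_eq_mul]
      congr 3
      have := Real.pi_pos.ne'
      push_cast
      field_simp
    · simp [hv]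
  have hi : IntervalIntegrable (fun x => Complex.exp (((-(2 * (N : ℝ) * x) : ℝ) : ℂ) * Complex.I)
      * (f x : ℂ)) MeasureTheory.volume a b := by
    refine ContinuousOn.intervalIntegrable (ContinuousOn.mul ?_ ?_)
    · exact Continuous.continuousOn (by fun_prop)
    · exact Complex.continuous_ofReal.comp_continuousOn hf
  simp only [Function.comp_apply]
  rw [funext e, MeasureTheory.integral_indicator measurableSet_Ioc,
    ← intervalIntegral.integral_of_le hab]
  have hre := Complex.reCLM.intervalIntegral_comp_comm hi
  simp only [Complex.reCLM_apply] at hre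
  rw [← hre]
  refine intervalIntegral.integral_congr fun x _ => ?_
  simp only [Complex.re_mul_ofReal, Complex.exp_ofReal_mul_I_re, Real.cos_neg]

/-- The summed sine kernel gives 2 ∑ x sin((2n+1)x) = (1 − cos 2Nx)/sinc x; the cosine part dies by
Riemann–Lebesgue, as 1/sinc is continuous even at 0. -/
lemma integral_inv_sinc :
    ∫ x in (0 : ℝ)..(Real.pi / 2), (Real.sinc x)⁻¹ = 2 * catalanConstant := by
  have hI : IntervalIntegrable (fun x => (Real.sinc x)⁻¹) MeasureTheory.volume 0 (Real.pi / 2) :=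
    continuousOn_inv_sinc.intervalIntegrable
  have h1 := hasSum_catalanConstant.tendsto_sum_nat.const_mul 2
  have h2 := (tendsto_integral_cos_mul (by positivity) continuousOn_inv_sinc).const_sub
    (∫ x in (0 : ℝ)..(Real.pi / 2), (Real.sinc x)⁻¹)
  rw [sub_zero] at h2
  refine tendsto_nhds_unique h2 (h1.congr fun N => ?_)
  have hs : ∑ n ∈ Finset.range N, (-1 : ℝ) ^ n / (2 * (n : ℝ) + 1) ^ 2
      = ∫ x in (0 : ℝ)..(Real.pi / 2),
        ∑ n ∈ Finset.range N, x * Real.sin ((2 * (n : ℝ) + 1) * x) := by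
    rw [intervalIntegral.integral_finsetSum fun n _ =>
      Continuous.intervalIntegrable (by fun_prop) _ _]
    exact Finset.sum_congr rfl fun n _ => (integral_mul_sin_odd n).symm
  have hC : IntervalIntegrable (fun x => Real.cos (2 * (N : ℝ) * x) * (Real.sinc x)⁻¹)
      MeasureTheory.volume 0 (Real.pi / 2) :=
    (ContinuousOn.mul (Continuous.continuousOn (by fun_prop))
      continuousOn_inv_sinc).intervalIntegrable
  rw [hs, ← intervalIntegral.integral_const_mul, ← intervalIntegral.integral_sub hI hC]
  refine intervalIntegral.integral_congr fun x hx => ?_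
  rw [Set.uIcc_of_le (by positivity)] at hx
  have hp := (sinc_pos_of_mem hx).ne'
  have hk := two_mul_sin_mul_sum_sin_odd N x
  rw [← sinc_mul_self] at hk
  simp only [← Finset.mul_sum]
  rw [← one_sub_mul, ← hk, eq_mul_inv_iff_mul_eq₀ hp]
  ring

/-! ### The arcsine series and the sum giving Catalan's constant -/

lemma integral_sin_pow_even_pi_div_two (k : ℕ) :
    ∫ x in (0 : ℝ)..(Real.pi / 2), Real.sin x ^ (2 * k) = Real.pi / 2 * centralRatio k := by
  induction k with
  | zero => simp [centralRatio]
  | succ k ih =>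
    rw [show 2 * (k + 1) = 2 * k + 2 from by ring, integral_sin_pow, ih, centralRatio_succ]
    simp
    ring

/-- The partial sums of the arcsine series at `sin x`. -/
noncomputable def arcsinPartial (N : ℕ) (x : ℝ) : ℝ :=
  ∑ k ∈ Finset.range N, centralRatio k / (2 * (k : ℝ) + 1) * Real.sin x ^ (2 * k + 1)

/-- The derivative of `x - arcsinPartial N x`. -/
noncomputable def arcsinDefect (N : ℕ) (x : ℝ) : ℝ :=
  1 - ∑ k ∈ Finset.range N, centralRatio k * Real.sin x ^ (2 * k) * Real.cos x

lemma hasDerivAt_sub_arcsinPartial (N : ℕ) (x : ℝ) :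
    HasDerivAt (fun x => x - arcsinPartial N x) (arcsinDefect N x) x := by
  unfold arcsinPartial arcsinDefect
  refine (hasDerivAt_id x).sub (HasDerivAt.fun_sum fun k _ => ?_)
  refine (((Real.hasDerivAt_sin x).pow (2 * k + 1)).const_mul _).congr_deriv ?_
  push_cast
  field_simp

/-- After cos² = 1 − sin², the relation (2N+2)β_{N+1} = (2N+1)β_N cancels all but the last term. -/
lemma hasDerivAt_arcsinDefect (N : ℕ) (x : ℝ) :
    HasDerivAt (arcsinDefect (N + 1))
      ((2 * (N : ℝ) + 1) * centralRatio N * Real.sin x ^ (2 * N + 1)) x := by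
  induction N with
  | zero =>
    have e : arcsinDefect (0 + 1) = fun x => 1 - Real.cos x := by
      funext x; simp [arcsinDefect, centralRatio]
    rw [e]
    simpa [centralRatio] using (Real.hasDerivAt_cos x).const_sub 1
  | succ N ih =>
    have e : arcsinDefect (N + 1 + 1) = fun x => arcsinDefect (N + 1) x
        - centralRatio (N + 1) * (Real.sin x ^ (2 * (N + 1)) * Real.cos x) := by
      funext x
      simp only [arcsinDefect, Finset.sum_range_succ _ (N + 1)]
      ring
    rw [e]
    refine (ih.sub ((((Real.hasDerivAt_sin x).pow (2 * (N + 1))).mul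
      (Real.hasDerivAt_cos x)).const_mul _)).congr_deriv ?_
    rw [show 2 * (N + 1) - 1 = 2 * N + 1 from by omega, centralRatio_succ]
    have hc := Real.cos_sq' x
    simp only [Pi.pow_apply]
    push_cast
    field_simp
    linear_combination (-(2 * (N : ℝ) + 2) * centralRatio N * Real.sin x ^ (2 * N + 1)) * hc

lemma arcsinDefect_zero (N : ℕ) : arcsinDefect (N + 1) 0 = 0 := by
  simp [arcsinDefect, Finset.sum_range_succ', centralRatio]

lemma arcsinDefect_mem {N : ℕ} {x : ℝ} (hx : x ∈ Set.Icc 0 (Real.pi / 2)) :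
    0 ≤ arcsinDefect (N + 1) x ∧
      arcsinDefect (N + 1) x ≤ (2 * (N : ℝ) + 1) * Real.sin x ^ (2 * N + 1) * x := by
  have hsin : ∀ y ∈ Set.Icc (0 : ℝ) x, 0 ≤ Real.sin y := fun y hy =>
    Real.sin_nonneg_of_nonneg_of_le_pi hy.1 (by linarith [hy.2, hx.2, Real.pi_pos])
  rcases hx.1.eq_or_lt with h0 | h0
  · rw [← h0, arcsinDefect_zero]; simp
  obtain ⟨c, hc, hc'⟩ := exists_hasDerivAt_eq_slope (arcsinDefect (N + 1)) _ h0
    (fun y _ => (hasDerivAt_arcsinDefect N y).continuousAt.continuousWithinAt)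
    (fun y _ => hasDerivAt_arcsinDefect N y)
  rw [arcsinDefect_zero, sub_zero, sub_zero, eq_div_iff h0.ne'] at hc'
  have hs := hsin c ⟨hc.1.le, hc.2.le⟩
  rw [← hc']
  have := (centralRatio_pos N).le
  refine ⟨by positivity, ?_⟩
  have hle : Real.sin c ≤ Real.sin x :=
    Real.sin_le_sin_of_le_of_le_pi_div_two (by linarith [hc.1, Real.pi_pos]) hx.2 hc.2.le
  have := centralRatio_le_one N
  calc (2 * (N : ℝ) + 1) * centralRatio N * Real.sin c ^ (2 * N + 1) * x
      ≤ (2 * (N : ℝ) + 1) * 1 * Real.sin x ^ (2 * N + 1) * x := by gcongr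
    _ = _ := by ring

lemma sub_arcsinPartial_mem {N : ℕ} {x : ℝ} (hx : x ∈ Set.Icc 0 (Real.pi / 2)) :
    0 ≤ x - arcsinPartial (N + 1) x ∧
      x - arcsinPartial (N + 1) x ≤ (2 * (N : ℝ) + 1) * Real.sin x ^ (2 * N + 1) * x * x := by
  rcases hx.1.eq_or_lt with h0 | h0
  · simp [← h0, arcsinPartial]
  obtain ⟨c, hc, hc'⟩ := exists_hasDerivAt_eq_slope (fun x => x - arcsinPartial (N + 1) x) _ h0
    (fun y _ => (hasDerivAt_sub_arcsinPartial (N + 1) y).continuousAt.continuousWithinAt)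
    (fun y _ => hasDerivAt_sub_arcsinPartial (N + 1) y)
  have hz : arcsinPartial (N + 1) 0 = 0 := by simp [arcsinPartial]
  rw [hz, sub_zero, sub_zero, sub_zero, eq_div_iff h0.ne'] at hc'
  have hcm : c ∈ Set.Icc 0 (Real.pi / 2) := ⟨hc.1.le, hc.2.le.trans hx.2⟩
  obtain ⟨h1, h2⟩ := arcsinDefect_mem (N := N) hcm
  rw [← hc']
  refine ⟨by positivity, mul_le_mul_of_nonneg_right (h2.trans ?_) h0.le⟩
  have hs : 0 ≤ Real.sin c :=
    Real.sin_nonneg_of_nonneg_of_le_pi hcm.1 (by linarith [hcm.2, Real.pi_pos])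
  have hle : Real.sin c ≤ Real.sin x :=
    Real.sin_le_sin_of_le_of_le_pi_div_two (by linarith [hc.1, Real.pi_pos]) hx.2 hc.2.le
  have := hc.2.le
  have := hc.1.le
  have := hs.trans hle
  gcongr

lemma tendsto_arcsinPartial {x : ℝ} (hx : x ∈ Set.Ico 0 (Real.pi / 2)) :
    Filter.Tendsto (fun N => arcsinPartial N x) Filter.atTop (nhds x) := by
  have hxm : x ∈ Set.Icc 0 (Real.pi / 2) := ⟨hx.1, hx.2.le⟩
  rw [← Filter.tendsto_add_atTop_iff_nat 1]
  have hs : 0 ≤ Real.sin x :=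
    Real.sin_nonneg_of_nonneg_of_le_pi hx.1 (by linarith [hx.2, Real.pi_pos])
  have hlt : Real.sin x < 1 := by
    have := Real.sin_lt_sin_of_lt_of_le_pi_div_two (by linarith [hx.1, Real.pi_pos]) le_rfl hx.2
    rwa [Real.sin_pi_div_two] at this
  have hinj : Filter.Tendsto (fun N : ℕ => 2 * N + 1) Filter.atTop Filter.atTop :=
    Filter.tendsto_atTop_mono (fun N => by simp only [id]; omega) Filter.tendsto_id
  have h0 := (((tendsto_self_mul_const_pow_of_lt_one hs hlt).comp hinj).mul_const x).mul_const x
  rw [zero_mul, zero_mul] at h0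
  have h1 : Filter.Tendsto (fun N => x - arcsinPartial (N + 1) x) Filter.atTop (nhds 0) := by
    refine squeeze_zero (fun N => (sub_arcsinPartial_mem hxm).1)
      (fun N => (sub_arcsinPartial_mem hxm).2) (h0.congr fun N => ?_)
    simp
  simpa using h1.const_sub x

lemma hasSum_centralRatio_sq_div_odd :
    HasSum (fun k : ℕ => centralRatio k ^ 2 / (2 * (k : ℝ) + 1))
      (4 * catalanConstant / Real.pi) := by
  rw [hasSum_iff_tendsto_nat_of_nonneg fun k => by positivity]
  set F : ℕ → ℝ → ℝ := fun N x =>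
    ∑ k ∈ Finset.range N, centralRatio k / (2 * (k : ℝ) + 1) * Real.sin x ^ (2 * k) with hF
  have hFs : ∀ N x, F N x * Real.sin x = arcsinPartial N x := fun N x => by
    simp only [hF, arcsinPartial, Finset.sum_mul, pow_succ, mul_assoc]
  have hFc : ∀ N, Continuous (F N) := fun N => by
    simp only [hF]
    fun_prop
  have hlim : Filter.Tendsto (fun N => ∫ x in (0 : ℝ)..(Real.pi / 2), F (N + 1) x) Filter.atTop
      (nhds (∫ x in (0 : ℝ)..(Real.pi / 2), (Real.sinc x)⁻¹)) := by
    refine intervalIntegral.tendsto_integral_filter_of_dominated_convergence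
      (fun x => (Real.sinc x)⁻¹) (.of_forall fun N => (hFc _).aestronglyMeasurable)
      -- Domination holds because the arcsine partial sums never exceed x.
      (.of_forall fun N => .of_forall fun x hx => ?_) continuousOn_inv_sinc.intervalIntegrable ?_
    · rw [Set.uIoc_of_le (by positivity)] at hx
      have hxm : x ∈ Set.Icc 0 (Real.pi / 2) := ⟨hx.1.le, hx.2⟩
      have hs : 0 < Real.sin x :=
        Real.sin_pos_of_pos_of_lt_pi hx.1 (by linarith [hx.2, Real.pi_pos])
      have hnn : 0 ≤ F (N + 1) x := Finset.sum_nonneg fun k _ => by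
        have := (centralRatio_pos k).le
        positivity
      have h := (sub_arcsinPartial_mem (N := N) hxm).1
      rw [Real.norm_of_nonneg hnn, Real.sinc_of_ne_zero hx.1.ne', inv_div, le_div_iff₀ hs, hFs]
      linarith
    -- The error bound tends to 0 only where sin x < 1, so the endpoint π/2 is discarded as a null
    -- set.
    · filter_upwards [MeasureTheory.Measure.ae_ne MeasureTheory.volume (Real.pi / 2)] with x hne hx
      rw [Set.uIoc_of_le (by positivity)] at hx
      have hs : 0 < Real.sin x :=
        Real.sin_pos_of_pos_of_lt_pi hx.1 (by linarith [hx.2, Real.pi_pos])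
      have h := ((Filter.tendsto_add_atTop_iff_nat 1).mpr
        (tendsto_arcsinPartial ⟨hx.1.le, lt_of_le_of_ne hx.2 hne⟩)).div_const (Real.sin x)
      rw [Real.sinc_of_ne_zero hx.1.ne', inv_div]
      refine h.congr fun N => ?_
      rw [← hFs, mul_div_cancel_right₀ _ hs.ne']
  rw [integral_inv_sinc, Filter.tendsto_add_atTop_iff_nat
    (f := fun N => ∫ x in (0 : ℝ)..(Real.pi / 2), F N x) 1] at hlim
  have h := hlim.mul_const (2 / Real.pi)
  have e : 2 * catalanConstant * (2 / Real.pi) = 4 * catalanConstant / Real.pi := by ring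
  rw [e] at h
  refine h.congr fun N => ?_
  simp only [hF]
  rw [intervalIntegral.integral_finsetSum fun k _ =>
    Continuous.intervalIntegrable (by fun_prop) _ _, Finset.sum_mul]
  refine Finset.sum_congr rfl fun k _ => ?_
  rw [intervalIntegral.integral_const_mul, integral_sin_pow_even_pi_div_two]
  have := Real.pi_pos.ne'
  field_simp

lemma pi_div_four_le_catalanConstant : Real.pi / 4 ≤ catalanConstant := by
  have h := hasSum_centralRatio_sq_div_odd.summable.le_tsum 0 fun k _ => by positivity
  rw [hasSum_centralRatio_sq_div_odd.tsum_eq] at h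
  rw [centralRatio_zero, le_div_iff₀ Real.pi_pos] at h
  norm_num at h
  linarith

/-! ### Minimal and dominant solutions -/

/-- The minimal solution of the three-term recurrence. -/
noncomputable def minimalSolution (m : ℕ) : ℝ := Real.pi / 4 * (m - betaMoment m / 2)

lemma minimalSolution_zero : minimalSolution 0 = 1 / 2 - catalanConstant := by
  have := Real.pi_pos.ne'
  rw [minimalSolution, betaMoment_zero hasSum_centralRatio_sq_div_odd]
  push_cast
  field_simp
  ring

lemma minimalSolution_one : minimalSolution 1 = 3 / 2 - catalanConstant := by
  have h := betaMoment_zero_sub_one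
  have h0 := minimalSolution_zero
  have := Real.pi_pos.ne'
  have h' : Real.pi * (betaMoment 0 - betaMoment 1) = 8 - 2 * Real.pi := by
    rw [h]; field_simp
  simp only [minimalSolution] at *
  push_cast at *
  linarith

lemma minimalSolution_recurrence (p : ℕ) :
    ((p : ℝ) + 2) ^ 2 * minimalSolution (p + 2)
      = (3 * ((p : ℝ) + 2) ^ 2 - 3 * ((p : ℝ) + 2) + 1) * minimalSolution (p + 1)
        - 2 * ((p : ℝ) + 2) * ((p : ℝ) + 1) * minimalSolution p := by
  have h := betaMoment_recurrence p
  simp only [minimalSolution]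
  push_cast
  linear_combination (-(Real.pi / 8)) * h

lemma abs_minimalSolution_le (m : ℕ) : |minimalSolution m| ≤ m + 1 := by
  have h1 := betaMoment_nonneg m
  have h2 := betaMoment_le m
  have h3 := Real.pi_pos
  have h4 := Real.pi_le_four
  have h5 : Real.pi * betaMoment m ≤ 4 := by rwa [mul_comm, ← le_div_iff₀ h3]
  have h6 : 0 ≤ Real.pi * betaMoment m := by positivity
  have h7 : Real.pi * m ≤ 4 * m := by gcongr
  have h8 : 0 ≤ Real.pi * m := by positivity
  have h9 : (0 : ℝ) ≤ m := m.cast_nonneg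
  rw [minimalSolution, abs_le]
  constructor <;> linarith

/-- Uniqueness for the three-term recurrence. -/
lemma eq_add_mul_of_recurrence {u v w : ℕ → ℝ} {c : ℝ}
    (hu : ∀ p : ℕ, ((p : ℝ) + 2) ^ 2 * u (p + 2) = (3 * ((p : ℝ) + 2) ^ 2 - 3 * ((p : ℝ) + 2) + 1)
      * u (p + 1) - 2 * ((p : ℝ) + 2) * ((p : ℝ) + 1) * u p)
    (hv : ∀ p : ℕ, ((p : ℝ) + 2) ^ 2 * v (p + 2) = (3 * ((p : ℝ) + 2) ^ 2 - 3 * ((p : ℝ) + 2) + 1)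
      * v (p + 1) - 2 * ((p : ℝ) + 2) * ((p : ℝ) + 1) * v p)
    (hw : ∀ p : ℕ, ((p : ℝ) + 2) ^ 2 * w (p + 2) = (3 * ((p : ℝ) + 2) ^ 2 - 3 * ((p : ℝ) + 2) + 1)
      * w (p + 1) - 2 * ((p : ℝ) + 2) * ((p : ℝ) + 1) * w p)
    (h0 : u 0 = v 0 + c * w 0) (h1 : u 1 = v 1 + c * w 1) (m : ℕ) : u m = v m + c * w m := by
  induction m using Nat.twoStepInduction with
  | zero => exact h0
  | one => exact h1
  | more p ih1 ih2 =>
    have hp : ((p : ℝ) + 2) ^ 2 ≠ 0 := by positivity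
    refine mul_left_cancel₀ hp ?_
    rw [mul_add, mul_left_comm, hu, hv, hw, ih1, ih2]
    ring

/-- With m = n + 12, a ratio of at least 3/2 persists once m²/6 − 5m/3 + 1 ≥ 0, true for m ≥ 10; the
first values are computed by hand. -/
lemma dominant_growth {w : ℕ → ℝ}
    (hw : ∀ p : ℕ, ((p : ℝ) + 2) ^ 2 * w (p + 2) = (3 * ((p : ℝ) + 2) ^ 2 - 3 * ((p : ℝ) + 2) + 1)
      * w (p + 1) - 2 * ((p : ℝ) + 2) * ((p : ℝ) + 1) * w p)
    (h0 : w 0 = 1) (h1 : w 1 = 1) (n : ℕ) :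
    w (n + 10) < 0 ∧ w (n + 11) ≤ 3 / 2 * w (n + 10) := by
  induction n with
  | zero =>
    have e2 := hw 0
    have e3 := hw 1
    have e4 := hw 2
    have e5 := hw 3
    have e6 := hw 4
    have e7 := hw 5
    have e8 := hw 6
    have e9 := hw 7
    have e10 := hw 8
    have e11 := hw 9
    norm_num [h0, h1] at e2 e3 e4 e5 e6 e7 e8 e9 e10 e11 ⊢
    constructor <;> linarith
  | succ n ih =>
    obtain ⟨i1, i2⟩ := ih
    have h := hw (n + 10)
    push_cast at h
    have hn : (0 : ℝ) ≤ n := n.cast_nonneg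
    refine ⟨by rw [show n + 1 + 10 = n + 11 from by ring]; linarith, ?_⟩
    have e : n + 10 + 1 = n + 11 := rfl
    have e' : n + 10 + 2 = n + 12 := rfl
    rw [e, e'] at h
    rw [show n + 1 + 10 = n + 11 from by ring, show n + 1 + 11 = n + 12 from by ring]
    have hp : (0 : ℝ) < ((n : ℝ) + 10 + 2) ^ 2 := by positivity
    refine le_of_mul_le_mul_left ?_ hp
    rw [h]
    have hm : 0 ≤ 2 * ((n : ℝ) + 10 + 2) * ((n : ℝ) + 10 + 1) * (w (n + 10) - 2 / 3 * w (n + 11)) :=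
      mul_nonneg (by positivity) (by linarith)
    -- Beyond `hm`, the surplus is (n² + 14n + 30)/6 times −w(n+11), so a sixth of this bound
    -- suffices.
    have hq : 0 ≤ ((n : ℝ) ^ 2 + 14 * n + 26) * (-w (n + 11)) :=
      mul_nonneg (by positivity) (by linarith)
    nlinarith

lemma tendsto_minimalSolution_div {w : ℕ → ℝ}
    (hw : ∀ n, w (n + 10) < 0 ∧ w (n + 11) ≤ 3 / 2 * w (n + 10)) :
    Filter.Tendsto (fun m => minimalSolution m / w m) Filter.atTop (nhds 0) := by
  have hg : ∀ n : ℕ, (3 / 2 : ℝ) ^ n * (-w 10) ≤ -w (n + 10) := by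
    intro n
    induction n with
    | zero => simp
    | succ n ih =>
      have := (hw n).2
      rw [show n + 1 + 10 = n + 11 from by ring, pow_succ]
      linarith
  have hw10 : 0 < -w 10 := by linarith [(hw 0).1]
  rw [← Filter.tendsto_add_atTop_iff_nat 10]
  have t1 := tendsto_self_mul_const_pow_of_lt_one (r := (2 / 3 : ℝ)) (by norm_num) (by norm_num)
  have t2 := (tendsto_pow_atTop_nhds_zero_of_lt_one (r := (2 / 3 : ℝ)) (by norm_num)
    (by norm_num)).const_mul 11
  have t := (t1.add t2).div_const (-w 10)
  rw [mul_zero, add_zero, zero_div] at t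
  refine squeeze_zero_norm (fun n => ?_) t
  have hb := abs_minimalSolution_le (n + 10)
  push_cast at hb
  rw [norm_div, Real.norm_eq_abs, Real.norm_eq_abs, abs_of_neg (hw n).1]
  calc |minimalSolution (n + 10)| / -w (n + 10)
      ≤ ((n : ℝ) + 10 + 1) / ((3 / 2 : ℝ) ^ n * (-w 10)) := by
        gcongr
        exact hg n
    _ = ((n : ℝ) * (2 / 3) ^ n + 11 * (2 / 3) ^ n) / -w 10 := by
        have : ((2 : ℝ) / 3) ^ n = ((3 / 2 : ℝ) ^ n)⁻¹ := by rw [← inv_pow]; norm_num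
        rw [this]
        field_simp
        ring

/-! ### Continuants of the continued fraction -/

/-- Normalised continuants, with a prescribed entry at index `-1` moved to index `0`. -/
noncomputable def normalizedContinuant (x : ℕ → ℝ) (c : ℝ) : ℕ → ℝ
  | 0 => c
  | n + 1 => x n / ((n + 1).factorial : ℝ) ^ 2

/-- The factorials reduce −2n³(n+1) to −2n(n+1). The hypothesis `h1` is the step from index −1, with
a_1 = 7 and b_1 = −4, and covers p = 0. -/
lemma normalizedContinuant_recurrence {x : ℕ → ℝ} {c : ℝ}
    (h1 : x 1 = 7 * x 0 - 4 * c)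
    (hx : ∀ n : ℕ, x (n + 2) = (3 * ((n : ℝ) + 2) ^ 2 + 3 * ((n : ℝ) + 2) + 1) * x (n + 1)
      + -2 * ((n : ℝ) + 2) ^ 3 * ((n : ℝ) + 2 + 1) * x n) (p : ℕ) :
    ((p : ℝ) + 2) ^ 2 * normalizedContinuant x c (p + 2)
      = (3 * ((p : ℝ) + 2) ^ 2 - 3 * ((p : ℝ) + 2) + 1) * normalizedContinuant x c (p + 1)
        - 2 * ((p : ℝ) + 2) * ((p : ℝ) + 1) * normalizedContinuant x c p := by
  cases p with
  | zero => norm_num [normalizedContinuant, h1]; ring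
  | succ n =>
    simp only [normalizedContinuant, hx, Nat.factorial_succ]
    push_cast
    have := n.factorial_ne_zero
    field_simp
    ring

lemma contFrac_nums_recurrence (a b : ℕ → ℝ) (n : ℕ) :
    (contFrac a b).nums (n + 2)
      = a (n + 2) * (contFrac a b).nums (n + 1) + b (n + 2) * (contFrac a b).nums n :=
  GenContFract.nums_recurrence (gp := ⟨b (n + 2), a (n + 2)⟩) rfl rfl rfl

lemma contFrac_dens_recurrence (a b : ℕ → ℝ) (n : ℕ) :
    (contFrac a b).dens (n + 2)
      = a (n + 2) * (contFrac a b).dens (n + 1) + b (n + 2) * (contFrac a b).dens n :=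
  GenContFract.dens_recurrence (gp := ⟨b (n + 2), a (n + 2)⟩) rfl rfl rfl

lemma contFrac_nums_one (a b : ℕ → ℝ) : (contFrac a b).nums 1 = a 1 * a 0 + b 1 :=
  GenContFract.first_num_eq (gp := ⟨b 1, a 1⟩) rfl

lemma contFrac_dens_one (a b : ℕ → ℝ) : (contFrac a b).dens 1 = a 1 :=
  GenContFract.first_den_eq (gp := ⟨b 1, a 1⟩) rfl

theorem corollary2p2 :
    ContFracHasValue
      (fun n : ℕ => 3 * (n : ℝ) ^ 2 + 3 * (n : ℝ) + 1)
      (fun n : ℕ => -2 * (n : ℝ) ^ 3 * ((n : ℝ) + 1))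
      (2 / (2 * catalanConstant - 1)) := by
  set a : ℕ → ℝ := fun n : ℕ => 3 * (n : ℝ) ^ 2 + 3 * (n : ℝ) + 1 with ha
  set b : ℕ → ℝ := fun n : ℕ => -2 * (n : ℝ) ^ 3 * ((n : ℝ) + 1) with hb
  set A : ℕ → ℝ := (contFrac a b).nums with hA
  set B : ℕ → ℝ := (contFrac a b).dens with hB
  have hA0 : A 0 = 1 := by
    rw [hA, GenContFract.zeroth_num_eq_h]
    simp [contFrac, ha]
  have hB0 : B 0 = 1 := GenContFract.zeroth_den_eq_one
  have hA1 : A 1 = 7 * A 0 - 4 * 1 := by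
    rw [hA0, hA, contFrac_nums_one]
    norm_num [ha, hb]
  have hB1 : B 1 = 7 * B 0 - 4 * 0 := by
    rw [hB0, hB, contFrac_dens_one]
    norm_num [ha]
  set u := normalizedContinuant A 1 with hu
  set v := normalizedContinuant B 0 with hv
  have hur := normalizedContinuant_recurrence hA1 fun n => by
    have h := contFrac_nums_recurrence a b n
    simp only [ha, hb] at h ⊢
    push_cast at h
    exact h
  have hvr := normalizedContinuant_recurrence hB1 fun n => by
    have h := contFrac_dens_recurrence a b n
    simp only [ha, hb] at h ⊢
    push_cast at h
    exact h
  have hu0 : u 0 = 1 := rfl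
  have hv0 : v 0 = 0 := rfl
  have hu1 : u 1 = 1 := by simp [hu, normalizedContinuant, hA0]
  have hv1 : v 1 = 1 := by simp [hv, normalizedContinuant, hB0]
  have hrel := eq_add_mul_of_recurrence (c := catalanConstant - 1 / 2) hvr
    minimalSolution_recurrence hur
    (by rw [← hu, ← hv, hu0, hv0, minimalSolution_zero]; ring)
    (by rw [← hu, ← hv, hu1, hv1, minimalSolution_one]; ring)
  rw [← hu, ← hv] at hrel
  have hgrow := dominant_growth hur hu0 hu1
  have hLpos : 0 < catalanConstant - 1 / 2 := by
    linarith [pi_div_four_le_catalanConstant, Real.pi_gt_three]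
  have hlim : Filter.Tendsto (fun m => v m / u m) Filter.atTop
      (nhds (catalanConstant - 1 / 2)) := by
    have h := (tendsto_minimalSolution_div hgrow).add_const (catalanConstant - 1 / 2)
    rw [zero_add] at h
    refine h.congr' ?_
    filter_upwards [Filter.eventually_ge_atTop 10] with m hm
    obtain ⟨n, rfl⟩ := Nat.exists_eq_add_of_le' hm
    have hne := (hgrow n).1.ne
    rw [hrel, add_div, mul_div_assoc, div_self hne, mul_one]
  -- The inverted quotient is used since only the numerators are known to be eventually nonzero; its
  -- nonzero limit then yields the same for the denominators.
  have hBA : Filter.Tendsto (fun n => B n / A n) Filter.atTop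
      (nhds (catalanConstant - 1 / 2)) := by
    refine ((Filter.tendsto_add_atTop_iff_nat 1).mpr hlim).congr fun n => ?_
    simp only [hu, hv, normalizedContinuant]
    exact div_div_div_cancel_right₀ (by positivity) _ _
  constructor
  · filter_upwards [hBA.eventually_ne hLpos.ne'] with n hn h
    exact hn (div_eq_zero_iff.mpr (Or.inl h))
  · have h := hBA.inv₀ hLpos.ne'
    have e : (catalanConstant - 1 / 2)⁻¹ = 2 / (2 * catalanConstant - 1) := by
      rw [inv_eq_one_div, div_eq_div_iff hLpos.ne' (by linarith)]
      ring
    rw [e] at h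
    exact h.congr fun n => inv_div _ _
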